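/- Let $\mathcal C$ be a $k$-uniform clutter on a finite vertex set $V$, i.e. a set $E(\mathcal C)$ of subsets of $V$ (the edges), none containing another, each with exactly $k$ elements. Let $\mathbb K$ be a field, $S=\mathbb K[x_v : v\in V]$, and let $I(\mathcal C)=\big(\prod_{v\in e}x_v : e\in E(\mathcal C)\big)\subseteq S$ be the edge ideal of $\mathcal C$. An induced matching of $\mathcal C$ is a set of pairwise disjoint edges $e_1,\dots,e_t$ such that $e_1,\dots,e_t$ are the only edges of $\mathcal C$ contained in $e_1\cup\dots\cup e_t$; let $\mathrm{Indmath}(\mathcal C)$ be the maximum cardinality of an induced matching of $\mathcal C$. For a nonzero monomial ideal $I\subseteq S$ let $\beta_{i,j}(I)$ be the number of basis elements of degree $j$ in the $i$-th module ($i\ge 0$) of the minimal multigraded free resolution $\cdots\to F_1\to F_0\to I\to 0$ of $I$, and let $\mathrm{reg}(I)=\max\{j : \beta_{i,i+j}(I)\neq 0 \text{ for some } i\}$ be its Castelnuovo–Mumford regularity. Then for every integer $s\ge 2$: (i) if $\mathrm{Indmath}(\mathcal C)=2$, then $\mathrm{reg}(I(\mathcal C)^s)\ge ks+k-1$; (ii)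 if $\mathrm{Indmath}(\mathcal C)\ge 3$, then $\mathrm{reg}(I(\mathcal C)^s)\ge ks+2k-2$. -/

import Mathlib

open MvPolynomial

/-- A clutter on the vertex type `V`: a set of subsets of `V` (the edges), none of which contains
another one. -/
structure Clutter (V : Type*) where
  edges : Finset (Finset V)
  antichain : ∀ e ∈ edges, ∀ f ∈ edges, e ⊆ f → e = f

namespace Clutter

variable {V : Type*}

/-- Every edge has exactly `k` vertices. -/
def IsUniform (C : Clutter V) (k : ℕ) : Prop :=
  ∀ e ∈ C.edges, e.card = k

/-- A set `M` of edges is an induced matching if its members are pairwise disjoint and they are the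
only edges contained in their union. -/
def IsInducedMatching [DecidableEq V] (C : Clutter V) (M : Finset (Finset V)) : Prop :=
  M ⊆ C.edges ∧ (∀ e ∈ M, ∀ f ∈ M, e ≠ f → Disjoint e f) ∧
    ∀ e ∈ C.edges, e ⊆ M.biUnion id → e ∈ M

/-- The induced matching number: the maximum cardinality of an induced matching. -/
noncomputable def indMatch [DecidableEq V] (C : Clutter V) : ℕ :=
  open Classical in (C.edges.powerset.filter C.IsInducedMatching).sup Finset.card

/-- The edge ideal of `C` in `K[x_v : v ∈ V]`, generated by the monomials `∏ v ∈ e, x_v` for the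
edges `e`. -/
noncomputable def edgeIdeal (C : Clutter V) (K : Type*) [Field K] : Ideal (MvPolynomial V K) :=
  Ideal.span {m | ∃ e ∈ C.edges, m = ∏ v ∈ e, X v}

end Clutter

/-- A multigraded free resolution
`⋯ ⟶ F₂ ⟶ F₁ ⟶ F₀ ⟶ I ⟶ 0` of an ideal `I` of the polynomial ring `S = K[x_v : v ∈ σ]`.
Here `F i` is the free module `S ^ (rank i)`, whose basis element `b` is placed in multidegree
`deg i b`, so that `F i` is the direct sum of the `S(-deg i b)`.  An element `w` of `F i` is
homogeneous of multidegree `a` iff every monomial `x^m` in its `b`-th coordinate satisfies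
`m + deg i b = a`; a map is graded iff it sends each basis element to a homogeneous element of the
same multidegree.  Resolutions are indexed by `ℕ`; one of finite length has `rank i = 0` for all
large `i`.  Multidegrees are in `ℕ^σ` because that is where the degrees of a minimal
resolution of an ideal lie. -/
structure MultigradedFreeResolution {σ K : Type*} [Field K] (I : Ideal (MvPolynomial σ K)) where
  rank : ℕ → ℕ
  deg : ∀ i, Fin (rank i) → (σ →₀ ℕ)
  d : ∀ i, (Fin (rank (i + 1)) → MvPolynomial σ K) →ₗ[MvPolynomial σ K]
    (Fin (rank i) → MvPolynomial σ K)
  /-- The augmentation `F₀ ⟶ I`, as a map into the polynomial ring with image `I`. -/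
  aug : (Fin (rank 0) → MvPolynomial σ K) →ₗ[MvPolynomial σ K] MvPolynomial σ K
  graded_d : ∀ i (b : Fin (rank (i + 1))) (c : Fin (rank i)),
    ∀ m ∈ (d i (Pi.single b 1) c).support, m + deg i c = deg (i + 1) b
  graded_aug : ∀ b : Fin (rank 0), ∀ m ∈ (aug (Pi.single b 1)).support, m = deg 0 b
  range_aug : LinearMap.range aug = I
  exact_zero : LinearMap.ker aug = LinearMap.range (d 0)
  exact_succ : ∀ i, LinearMap.ker (d i) = LinearMap.range (d (i + 1))

namespace MultigradedFreeResolution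

variable {σ K : Type*} [Field K] {I : Ideal (MvPolynomial σ K)}

/-- The resolution is minimal: `d (F (i + 1)) ⊆ 𝔪 F i` for all `i`, where `𝔪` is the ideal generated
by the variables. -/
def IsMinimal (F : MultigradedFreeResolution I) : Prop :=
  ∀ i, LinearMap.range (F.d i) ≤
    (Ideal.span (Set.range (X : σ → MvPolynomial σ K)) •
      (⊤ : Submodule (MvPolynomial σ K) (Fin (F.rank i) → MvPolynomial σ K)))

/-- The number of basis elements of `F i` of multidegree `a`. -/
def gradedRank [DecidableEq σ] (F : MultigradedFreeResolution I) (i : ℕ) (a : σ →₀ ℕ) : ℕ :=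
  (Finset.univ.filter fun b : Fin (F.rank i) => F.deg i b = a).card

end MultigradedFreeResolution

section Betti

variable {σ K : Type*} [DecidableEq σ] [Field K]

/-- The multigraded Betti number `β_{i,a}(I)` of a monomial ideal `I` in finitely many variables:
the number of basis elements of multidegree `a` in the `i`-th module of a minimal multigraded free
resolution of `I`.  It does not depend on the resolution; the value `0` is used if there is none,
which does not happen for monomial ideals. -/
noncomputable def multigradedBetti (I : Ideal (MvPolynomial σ K)) (i : ℕ) (a : σ →₀ ℕ) : ℕ :=
  open Classical in
  if h : ∃ F : MultigradedFreeResolution I, F.IsMinimal then h.choose.gradedRank i a else 0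

/-- The graded Betti number `β_{i,j}(I) = ∑_{|a| = j} β_{i,a}(I)`. -/
noncomputable def gradedBetti [Fintype σ] (I : Ideal (MvPolynomial σ K)) (i j : ℕ) : ℕ :=
  ∑ a ∈ Finset.finsuppAntidiag (Finset.univ : Finset σ) j, multigradedBetti I i a

/-- The Castelnuovo-Mumford regularity `max {j : β_{i,i+j}(I) ≠ 0 for some i}`, as a supremum in
`WithBot ℕ∞`. -/
noncomputable def cmRegularity [Fintype σ] (I : Ideal (MvPolynomial σ K)) : WithBot ℕ∞ :=
  sSup {r | ∃ i j : ℕ, gradedBetti I i (i + j) ≠ 0 ∧ r = (j : WithBot ℕ∞)}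

end Betti

/-! ### Multidegree strands: multigraded maps as scalar matrices. -/

section Strands

variable {σ K ι κ : Type*} [Field K]

/-! Let m_1, …, m_t be the monomials of the edges of an induced matching. An s-fold product of edge
monomials that divides a monomial in the m_j can only use these edges, so below such a degree I^s
looks like (m_1, …, m_t)^s with the m_j in disjoint variables. If every minimal resolution of I^s
has a basis element of degree a in homological degree i, then reg(I^s) ≥ |a| - i.

For t = 2 take a = m_1^s m_2. The only generators dividing it are m_1^s and m_1^(s-1) m_2, with lcm
a, so a is the degree of a first syzygy: the bound is k(s+1) - 1. For t = 3 take a = m_1^s m_2 m_3.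
Adding the relations around the triangle m_1^s, m_1^(s-1) m_2, m_1^(s-1) m_3 gives a second syzygy
of degree a: the bound is k(s+2) - 2.

Such basis elements are found by linear algebra. In degree b the module F_i is the K-space on the
basis elements of degree ≤ b, and the differential is given by one scalar matrix for all b. By
exactness, a degree where the kernel is nonzero but vanishes in all smaller degrees is the degree of
a basis element of the next module (`StrandExact.exists_deg_eq`). For second syzygies,
`StrandExact.ker_eq_zero` supplies the vanishing: strictly below a, all relations are generated in a
single degree. Uniqueness of minimal resolutions is never needed, but existence is
(`exists_minimal_resolution`), since `multigradedBetti` defaults to 0. -/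

/-- The vector `w` only involves basis elements whose degree divides `b`. -/
def SupportedBelow (deg : ι → σ →₀ ℕ) (b : σ →₀ ℕ) (w : ι → K) : Prop :=
  ∀ g, w g ≠ 0 → deg g ≤ b

theorem SupportedBelow.mono {deg : ι → σ →₀ ℕ} {b c : σ →₀ ℕ} {w : ι → K}
    (hw : SupportedBelow deg b w) (h : b ≤ c) : SupportedBelow deg c w :=
  fun g hg => (hw g hg).trans h

theorem SupportedBelow.add {deg : ι → σ →₀ ℕ} {b : σ →₀ ℕ} {v w : ι → K}
    (hv : SupportedBelow deg b v) (hw : SupportedBelow deg b w) :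
    SupportedBelow deg b (v + w) := by
  intro g hg
  by_cases h : v g = 0
  · exact hw g fun h' => hg (by simp [h, h'])
  · exact hv g h

theorem SupportedBelow.neg {deg : ι → σ →₀ ℕ} {b : σ →₀ ℕ} {w : ι → K}
    (hw : SupportedBelow deg b w) : SupportedBelow deg b (-w) :=
  fun g hg => hw g fun h => hg (by simp [h])

theorem supportedBelow_single [DecidableEq ι] {deg : ι → σ →₀ ℕ} {b : σ →₀ ℕ} {g : ι} (c : K)
    (h : deg g ≤ b) : SupportedBelow deg b (Pi.single g c) := by
  intro j hj
  obtain rfl : j = g := by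
    by_contra hne
    exact hj (by simp [hne])
  exact h

/-- The coordinates of the multidegree `b` part of an element of a multigraded free module. -/
noncomputable def strandCoord (deg : ι → σ →₀ ℕ) (b : σ →₀ ℕ) (w : ι → MvPolynomial σ K) : ι → K :=
  open Classical in fun g => if deg g ≤ b then coeff (b - deg g) (w g) else 0

/-- The element of multidegree `b` of a multigraded free module with the given coordinates. -/
noncomputable def strandLift (deg : ι → σ →₀ ℕ) (b : σ →₀ ℕ) (w : ι → K) : ι → MvPolynomial σ K :=
  fun g => monomial (b - deg g) (w g)

theorem strandCoord_supportedBelow (deg : ι → σ →₀ ℕ) (b : σ →₀ ℕ) (w : ι → MvPolynomial σ K) :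
    SupportedBelow deg b (strandCoord deg b w) := by
  intro g hg
  by_contra h
  exact hg (by simp [strandCoord, h])

theorem strandCoord_strandLift {deg : ι → σ →₀ ℕ} {b : σ →₀ ℕ} {w : ι → K}
    (hw : SupportedBelow deg b w) : strandCoord deg b (strandLift deg b w) = w := by
  classical
  funext g
  by_cases h : deg g ≤ b
  · rw [strandCoord, if_pos h, strandLift, coeff_monomial, if_pos rfl]
  · have : w g = 0 := by
      by_contra h0
      exact h (hw g h0)
    simp [strandCoord, h, this]

theorem strandLift_zero (deg : ι → σ →₀ ℕ) (b : σ →₀ ℕ) :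
    strandLift deg b (0 : ι → K) = 0 := by
  funext g; simp [strandLift]

theorem strandCoord_zero (deg : ι → σ →₀ ℕ) (b : σ →₀ ℕ) :
    strandCoord deg b (0 : ι → MvPolynomial σ K) = 0 := by
  funext g; simp [strandCoord]

/-- A map of free modules that sends each basis element to a homogeneous element of the same
multidegree. -/
def IsMultigraded [DecidableEq ι] (degι : ι → σ →₀ ℕ) (degκ : κ → σ →₀ ℕ)
    (φ : (ι → MvPolynomial σ K) →ₗ[MvPolynomial σ K] (κ → MvPolynomial σ K)) : Prop :=
  ∀ g h, ∀ m ∈ (φ (Pi.single g 1) h).support, m + degκ h = degι g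

/-- The matrix of scalars of a multigraded map, obtained by setting all variables to `1`. -/
noncomputable def strandMatrix [DecidableEq ι] (degι : ι → σ →₀ ℕ) (degκ : κ → σ →₀ ℕ)
    (φ : (ι → MvPolynomial σ K) →ₗ[MvPolynomial σ K] (κ → MvPolynomial σ K)) : Matrix κ ι K :=
  open Classical in
  Matrix.of fun h g => if degκ h ≤ degι g then coeff (degι g - degκ h) (φ (Pi.single g 1) h) else 0

variable [DecidableEq ι] {degι : ι → σ →₀ ℕ} {degκ : κ → σ →₀ ℕ}
    {φ : (ι → MvPolynomial σ K) →ₗ[MvPolynomial σ K] (κ → MvPolynomial σ K)}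

theorem le_of_strandMatrix_ne_zero {h : κ} {g : ι} (hne : strandMatrix degι degκ φ h g ≠ 0) :
    degκ h ≤ degι g := by
  by_contra hle
  exact hne (by simp [strandMatrix, hle])

theorem IsMultigraded.apply_single (hφ : IsMultigraded degι degκ φ) (g : ι) (h : κ) :
    φ (Pi.single g 1) h = monomial (degι g - degκ h) (strandMatrix degι degκ φ h g) := by
  classical
  ext m
  rw [coeff_monomial]
  by_cases hm : coeff m (φ (Pi.single g 1) h) = 0
  · rw [hm]
    split_ifs with hm'
    · subst hm'
      simp [strandMatrix, hm]
    · rfl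
  · have := hφ g h m (mem_support_iff.2 hm)
    have h1 : degκ h ≤ degι g := this ▸ le_add_self
    have h2 : degι g - degκ h = m := by rw [← this]; simp
    simp [strandMatrix, h1, h2]

variable [Fintype ι]

theorem SupportedBelow.strandMatrix_mulVec {b : σ →₀ ℕ} {w : ι → K}
    (hw : SupportedBelow degι b w) :
    SupportedBelow degκ b ((strandMatrix degι degκ φ).mulVec w) := by
  intro h hne
  obtain ⟨g, -, hg⟩ := Finset.exists_ne_zero_of_sum_ne_zero hne
  exact (le_of_strandMatrix_ne_zero (left_ne_zero_of_mul hg)).trans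
    (hw g (right_ne_zero_of_mul hg))

theorem IsMultigraded.apply_eq_sum (hφ : IsMultigraded degι degκ φ) (w : ι → MvPolynomial σ K)
    (h : κ) :
    φ w h = ∑ g, w g * monomial (degι g - degκ h) (strandMatrix degι degκ φ h g) := by
  conv_lhs => rw [pi_eq_sum_univ' w]
  rw [map_sum, Finset.sum_apply]
  refine Finset.sum_congr rfl fun g _ => ?_
  rw [map_smul, Pi.smul_apply, smul_eq_mul, ← hφ.apply_single]

/-- The matrix entry of `φ` at `h`, `g` is a scalar times x^(`degι g - degκ h`), so the degree `b`
part of `φ w` only sees the degree `b` part of `w`, through scalars that do not depend on `b`. -/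
theorem IsMultigraded.strandCoord_apply (hφ : IsMultigraded degι degκ φ) (b : σ →₀ ℕ)
    (w : ι → MvPolynomial σ K) :
    strandCoord degκ b (φ w) = (strandMatrix degι degκ φ).mulVec (strandCoord degι b w) := by
  classical
  funext h
  by_cases hb : degκ h ≤ b
  · simp only [strandCoord, hb, if_true, hφ.apply_eq_sum, coeff_sum, Matrix.mulVec, dotProduct]
    refine Finset.sum_congr rfl fun g _ => ?_
    rw [coeff_mul_monomial']
    by_cases h0 : strandMatrix degι degκ φ h g = 0
    · simp [h0]
    have hle := le_of_strandMatrix_ne_zero h0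
    by_cases hg : degι g ≤ b
    · rw [if_pos (tsub_le_tsub_right hg _), if_pos hg, tsub_tsub_tsub_cancel_right hle, mul_comm]
    · rw [if_neg hg, if_neg, mul_zero]
      intro hc
      exact hg ((tsub_le_tsub_iff_right hb).1 hc)
  · by_contra hne
    refine hb ?_
    refine (strandCoord_supportedBelow degι b w).strandMatrix_mulVec (φ := φ) h fun h0 => hne ?_
    rw [h0]
    simp [strandCoord, hb]

theorem IsMultigraded.apply_strandLift (hφ : IsMultigraded degι degκ φ) {b : σ →₀ ℕ}
    {w : ι → K} (hw : SupportedBelow degι b w) :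
    φ (strandLift degι b w) = strandLift degκ b ((strandMatrix degι degκ φ).mulVec w) := by
  funext h
  rw [hφ.apply_eq_sum]
  simp only [strandLift, Matrix.mulVec, dotProduct, map_sum]
  refine Finset.sum_congr rfl fun g _ => ?_
  rw [monomial_mul, mul_comm]
  by_cases h0 : strandMatrix degι degκ φ h g * w g = 0
  · simp [h0]
  · rw [tsub_add_tsub_cancel (hw g (right_ne_zero_of_mul h0))
      (le_of_strandMatrix_ne_zero (left_ne_zero_of_mul h0))]

end Strands

/-! ### Existence of minimal multigraded resolutions of monomial ideals. -/

section Existence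

variable {σ K ι κ : Type*} [Field K]

/-- A submodule of a multigraded free module that contains the homogeneous components of each of
its elements. -/
def IsGradedSubmodule (deg : ι → σ →₀ ℕ)
    (N : Submodule (MvPolynomial σ K) (ι → MvPolynomial σ K)) : Prop :=
  ∀ w ∈ N, ∀ b, strandLift deg b (strandCoord deg b w) ∈ N

theorem strandLift_strandCoord_apply [DecidableEq (σ →₀ ℕ)] (deg : ι → σ →₀ ℕ) (b : σ →₀ ℕ)
    (w : ι → MvPolynomial σ K) (g : ι) :
    strandLift deg b (strandCoord deg b w) g =
      ∑ m ∈ (w g).support, if b = m + deg g then monomial m (coeff m (w g)) else 0 := by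
  classical
  by_cases hb : deg g ≤ b
  · have : ∀ m, b = m + deg g ↔ b - deg g = m := fun m =>
      (tsub_eq_iff_eq_add_of_le hb).symm
    simp only [this, Finset.sum_ite_eq, mem_support_iff]
    simp only [strandLift, strandCoord, if_pos hb]
    split_ifs with h
    · rfl
    · rw [not_not.1 h, monomial_zero]
  · rw [Finset.sum_eq_zero]
    · simp [strandLift, strandCoord, hb]
    · intro m _
      rw [if_neg]
      rintro rfl
      exact hb le_add_self

/-- An element of a multigraded free module is the sum of its homogeneous components. -/
theorem exists_eq_sum_strandLift [Fintype ι] (deg : ι → σ →₀ ℕ) (w : ι → MvPolynomial σ K) :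
    ∃ B : Finset (σ →₀ ℕ), w = ∑ b ∈ B, strandLift deg b (strandCoord deg b w) := by
  classical
  refine ⟨Finset.univ.biUnion fun g => (w g).support.image fun m => m + deg g, ?_⟩
  funext g
  simp only [Finset.sum_apply, strandLift_strandCoord_apply]
  rw [Finset.sum_comm]
  conv_lhs => rw [(w g).as_sum]
  refine Finset.sum_congr rfl fun m hm => ?_
  rw [Finset.sum_ite_eq', if_pos]
  exact Finset.mem_biUnion.2 ⟨g, Finset.mem_univ _, Finset.mem_image_of_mem _ hm⟩

variable {degι : ι → σ →₀ ℕ} {degκ : κ → σ →₀ ℕ}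
    {φ : (ι → MvPolynomial σ K) →ₗ[MvPolynomial σ K] (κ → MvPolynomial σ K)}

theorem IsMultigraded.isGradedSubmodule_ker [DecidableEq ι] [Fintype ι]
    (hφ : IsMultigraded degι degκ φ) : IsGradedSubmodule degι (LinearMap.ker φ) := by
  intro w hw b
  rw [LinearMap.mem_ker] at hw ⊢
  rw [hφ.apply_strandLift (strandCoord_supportedBelow _ _ _), ← hφ.strandCoord_apply, hw,
    strandCoord_zero, strandLift_zero]

/-- A graded submodule has finitely many homogeneous generators. -/
theorem IsGradedSubmodule.exists_generators [Finite σ] [Fintype κ]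
    {N : Submodule (MvPolynomial σ K) (κ → MvPolynomial σ K)} (hN : IsGradedSubmodule degκ N) :
    ∃ (n : ℕ) (e : Fin n → σ →₀ ℕ) (w : Fin n → κ → K),
      (∀ g, SupportedBelow degκ (e g) (w g)) ∧ Submodule.span (MvPolynomial σ K)
        (Set.range fun g => strandLift degκ (e g) (w g)) = N := by
  classical
  obtain ⟨T, hT⟩ := (IsNoetherian.noetherian N)
  choose B hB using fun w : κ → MvPolynomial σ K => exists_eq_sum_strandLift degκ w
  -- The homogeneous components of a finite generating set, all of which lie in `N`.
  let P : Finset ((σ →₀ ℕ) × (κ → K)) :=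
    T.biUnion fun w => (B w).image fun b => (b, strandCoord degκ b w)
  refine ⟨P.card, fun g => (P.equivFin.symm g).1.1, fun g => (P.equivFin.symm g).1.2,
    fun g => ?_, le_antisymm ?_ ?_⟩
  · have := (P.equivFin.symm g).2
    simp only [P, Finset.mem_biUnion, Finset.mem_image] at this
    obtain ⟨w, -, b, -, h⟩ := this
    simp only [P, ← h]
    exact strandCoord_supportedBelow _ _ _
  · rw [Submodule.span_le]
    rintro _ ⟨g, rfl⟩
    have := (P.equivFin.symm g).2
    simp only [P, Finset.mem_biUnion, Finset.mem_image] at this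
    obtain ⟨w, hw, b, -, h⟩ := this
    simp only [P, ← h]
    exact hN w (hT ▸ Submodule.subset_span hw) b
  · rw [← hT, Submodule.span_le]
    intro w hw
    rw [SetLike.mem_coe, hB w]
    refine Submodule.sum_mem _ fun b hb => Submodule.subset_span ?_
    have hP : (b, strandCoord degκ b w) ∈ P :=
      Finset.mem_biUnion.2 ⟨w, hw, Finset.mem_image_of_mem _ hb⟩
    exact ⟨P.equivFin ⟨_, hP⟩, by simp⟩

/-- A submodule of a free module whose elements have coordinates without constant term. -/
def IsConstantFree (N : Submodule (MvPolynomial σ K) (ι → MvPolynomial σ K)) : Prop :=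
  ∀ w ∈ N, ∀ g, coeff 0 (w g) = 0

theorem IsConstantFree.le_smul_top [Fintype ι]
    {N : Submodule (MvPolynomial σ K) (ι → MvPolynomial σ K)} (hN : IsConstantFree N) :
    N ≤ Ideal.span (Set.range (X : σ → MvPolynomial σ K)) •
      (⊤ : Submodule (MvPolynomial σ K) (ι → MvPolynomial σ K)) := by
  classical
  intro w hw
  rw [pi_eq_sum_univ w]
  refine Submodule.sum_mem _ fun g _ => Submodule.smul_mem_smul ?_ trivial
  have h : w g ∈ idealOfVars σ K ^ 1 := by
    rw [mem_pow_idealOfVars_iff']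
    intro x hx
    rw [(Finsupp.degree_eq_zero_iff x).1 (Nat.lt_one_iff.1 hx)]
    exact hN w hw g
  rwa [pow_one] at h

theorem isConstantFree_of_le_smul_top
    {N : Submodule (MvPolynomial σ K) (ι → MvPolynomial σ K)}
    (hN : N ≤ Ideal.span (Set.range (X : σ → MvPolynomial σ K)) •
      (⊤ : Submodule (MvPolynomial σ K) (ι → MvPolynomial σ K))) : IsConstantFree N := by
  intro w hw g
  refine Submodule.smul_induction_on (p := fun w => coeff 0 (w g) = 0) (hN hw) ?_ ?_
  · intro r hr n _
    have : r ∈ RingHom.ker (constantCoeff (R := K) (σ := σ)) := by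
      refine (Ideal.span_le.2 ?_ : Ideal.span (Set.range X) ≤ _) hr
      rintro _ ⟨i, rfl⟩
      simp
    rw [RingHom.mem_ker] at this
    rw [← constantCoeff_eq, Pi.smul_apply, smul_eq_mul, map_mul, this, zero_mul]
  · intro x y hx hy
    simp [hx, hy]

/-- A graded submodule is the image of a multigraded map with a kernel that has no constant
coordinates: a minimal cover. -/
theorem IsGradedSubmodule.exists_minimal_cover [Finite σ] [Fintype κ]
    {N : Submodule (MvPolynomial σ K) (κ → MvPolynomial σ K)} (hN : IsGradedSubmodule degκ N) :
    ∃ (n : ℕ) (e : Fin n → σ →₀ ℕ)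
      (φ : (Fin n → MvPolynomial σ K) →ₗ[MvPolynomial σ K] (κ → MvPolynomial σ K)),
      IsMultigraded e degκ φ ∧ LinearMap.range φ = N ∧ IsConstantFree (LinearMap.ker φ) := by
  classical
  -- Minimality comes from taking the least possible number of homogeneous generators.
  have hex := hN.exists_generators
  obtain ⟨e, w, hw, hspan⟩ := Nat.find_spec hex
  have hmin := fun {m} => Nat.find_min hex (m := m)
  generalize Nat.find hex = n at e w hw hspan hmin
  have hrange : LinearMap.range (Fintype.linearCombination (MvPolynomial σ K)
      fun g => strandLift degκ (e g) (w g)) = N := by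
    rw [Fintype.range_linearCombination, hspan]
  have hgr : IsMultigraded e degκ (Fintype.linearCombination (MvPolynomial σ K)
      fun g => strandLift degκ (e g) (w g)) := by
    intro g h m hm
    rw [Fintype.linearCombination_apply_single, one_smul, strandLift, mem_support_iff,
      coeff_monomial, ne_eq, ite_eq_right_iff, Classical.not_imp] at hm
    rw [← hm.1, tsub_add_cancel_of_le (hw g h hm.2)]
  refine ⟨n, e, _, hgr, hrange, ?_⟩
  intro y hy g
  by_contra hne
  -- The component of the relation `y` in degree `e g` is again a relation, and its coordinate at
  -- `g` is a nonzero constant. Solving for the generator `g` makes it redundant.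
  have hy' := hgr.isGradedSubmodule_ker y hy (e g)
  set y' := strandLift e (e g) (strandCoord e (e g) y) with hy'def
  have hg : y' g = C (coeff 0 (y g)) := by
    simp [y', strandLift, strandCoord]
  rw [LinearMap.mem_ker, Fintype.linearCombination_apply] at hy'
  obtain ⟨m, rfl⟩ : ∃ m, n = m + 1 := ⟨n - 1, (Nat.succ_pred_eq_of_pos g.pos).symm⟩
  refine hmin (Nat.lt_succ_self m) ⟨e ∘ g.succAbove, w ∘ g.succAbove, fun j => hw _, ?_⟩
  rw [← hspan]
  refine le_antisymm (Submodule.span_mono ?_) (Submodule.span_le.2 ?_)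
  · rintro _ ⟨j, rfl⟩
    exact ⟨g.succAbove j, rfl⟩
  · rintro _ ⟨j, rfl⟩
    obtain rfl | ⟨j, rfl⟩ := Fin.eq_self_or_eq_succAbove g j
    · rw [Fin.sum_univ_succAbove _ j, hg, add_eq_zero_iff_eq_neg] at hy'
      have hsolve : strandLift degκ (e j) (w j) = (C (coeff 0 (y j))⁻¹ : MvPolynomial σ K) •
          -∑ i, y' (j.succAbove i) •
            strandLift degκ (e (j.succAbove i)) (w (j.succAbove i)) := by
        rw [← hy', smul_smul, ← C_mul, inv_mul_cancel₀ hne, C_1, one_smul]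
      simp only [SetLike.mem_coe]
      rw [hsolve]
      refine Submodule.smul_mem _ _ (Submodule.neg_mem _ (Submodule.sum_mem _ fun i _ =>
        Submodule.smul_mem _ _ (Submodule.subset_span ⟨i, rfl⟩)))
    · exact Submodule.subset_span ⟨j, rfl⟩

/-- A graded submodule of a multigraded free module of finite rank. -/
structure GradedSubmoduleStage (σ K : Type*) [Field K] where
  rank : ℕ
  deg : Fin rank → σ →₀ ℕ
  N : Submodule (MvPolynomial σ K) (Fin rank → MvPolynomial σ K)
  graded : IsGradedSubmodule deg N

namespace GradedSubmoduleStage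

variable [Finite σ]

/-- The rank of a minimal cover. -/
noncomputable def coverRank (A : GradedSubmoduleStage σ K) : ℕ :=
  A.graded.exists_minimal_cover.choose

/-- The degrees of a minimal cover. -/
noncomputable def coverDeg (A : GradedSubmoduleStage σ K) : Fin A.coverRank → σ →₀ ℕ :=
  A.graded.exists_minimal_cover.choose_spec.choose

/-- The map of a minimal cover. -/
noncomputable def cover (A : GradedSubmoduleStage σ K) :
    (Fin A.coverRank → MvPolynomial σ K) →ₗ[MvPolynomial σ K]
      (Fin A.rank → MvPolynomial σ K) :=
  A.graded.exists_minimal_cover.choose_spec.choose_spec.choose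

theorem cover_spec (A : GradedSubmoduleStage σ K) :
    IsMultigraded A.coverDeg A.deg A.cover ∧ LinearMap.range A.cover = A.N ∧
      IsConstantFree (LinearMap.ker A.cover) :=
  A.graded.exists_minimal_cover.choose_spec.choose_spec.choose_spec

/-- The kernel of a minimal cover. -/
noncomputable def next (A : GradedSubmoduleStage σ K) : GradedSubmoduleStage σ K where
  rank := A.coverRank
  deg := A.coverDeg
  N := LinearMap.ker A.cover
  graded := A.cover_spec.1.isGradedSubmodule_ker

/-- The iterated kernels of minimal covers. -/
noncomputable def iter (A : GradedSubmoduleStage σ K) : ℕ → GradedSubmoduleStage σ K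
  | 0 => A
  | n + 1 => (A.iter n).next

end GradedSubmoduleStage

/-- The ideal generated by monomials is graded. -/
theorem isGradedSubmodule_ideal (D : Set (σ →₀ ℕ)) :
    IsGradedSubmodule (fun _ : Fin 1 => 0)
      (Submodule.comap (LinearMap.proj (R := MvPolynomial σ K)
        (φ := fun _ : Fin 1 => MvPolynomial σ K) 0)
        (Ideal.span ((fun b => monomial b (1 : K)) '' D))) := by
  classical
  intro w hw b
  simp only [Submodule.mem_comap, LinearMap.proj_apply] at hw ⊢
  rw [mem_ideal_span_monomial_image] at hw ⊢
  intro m hm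
  refine hw m ?_
  rw [strandLift, mem_support_iff, coeff_monomial, ne_eq, ite_eq_right_iff,
    Classical.not_imp] at hm
  obtain ⟨rfl, hm⟩ := hm
  simpa [strandCoord] using hm

/-- Every monomial ideal in finitely many variables has a minimal multigraded free resolution. -/
theorem exists_minimal_resolution [Finite σ] (D : Set (σ →₀ ℕ)) :
    ∃ F : MultigradedFreeResolution (Ideal.span ((fun b => monomial b (1 : K)) '' D)),
      F.IsMinimal := by
  let A : GradedSubmoduleStage σ K := ⟨1, fun _ => 0, _, isGradedSubmodule_ideal D⟩
  have hker : ∀ i, LinearMap.ker (A.iter i).cover = LinearMap.range (A.iter (i + 1)).cover :=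
    fun i => (A.iter (i + 1)).cover_spec.2.1.symm
  let π := LinearMap.proj (R := MvPolynomial σ K) (φ := fun _ : Fin 1 => MvPolynomial σ K) 0
  have hπ : Function.Injective π := fun v w h => funext fun j => by
    rw [Subsingleton.elim j 0]
    exact h
  let ψ : (Fin A.coverRank → MvPolynomial σ K) →ₗ[MvPolynomial σ K]
    (Fin 1 → MvPolynomial σ K) := A.cover
  have hψ : LinearMap.range ψ =
      Submodule.comap π (Ideal.span ((fun b => monomial b (1 : K)) '' D)) := A.cover_spec.2.1
  have hrange : LinearMap.range (π ∘ₗ ψ) = Ideal.span ((fun b => monomial b (1 : K)) '' D) := by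
    rw [LinearMap.range_comp, hψ]
    exact Submodule.map_comap_eq_of_surjective (fun x => ⟨fun _ => x, rfl⟩) _
  have hker' : LinearMap.ker (π ∘ₗ ψ) = LinearMap.ker ψ := by
    rw [LinearMap.ker_comp, LinearMap.ker_eq_bot.2 hπ]
    rfl
  -- Index shift: stage 0 is the ideal inside S^1, and stage `i + 1` records the source of the
  -- `i`-th cover, so F_i is read off from stage `i + 1`.
  refine ⟨{ rank := fun i => (A.iter (i + 1)).rank
            deg := fun i => (A.iter (i + 1)).deg
            d := fun i => (A.iter (i + 1)).cover
            aug := π ∘ₗ ψ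
            graded_d := fun i b c m hm => (A.iter (i + 1)).cover_spec.1 b c m hm
            graded_aug := fun b m hm => ?_
            range_aug := hrange
            exact_zero := hker'.trans (hker 0)
            exact_succ := fun i => hker (i + 1) }, fun i => ?_⟩
  · exact (add_zero m).symm.trans (A.cover_spec.1 b 0 m hm)
  · refine IsConstantFree.le_smul_top ?_
    change IsConstantFree (LinearMap.range (A.iter (i + 1)).cover)
    rw [← hker i]
    exact (A.iter i).cover_spec.2.2

end Existence

/-! ### Exactness and minimality in each multidegree. -/

section StrandKernel

variable {σ K ι κ μ : Type*} [Field K] [Fintype ι]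

/-- The kernel of a matrix of scalars in a given multidegree. -/
def StrandKer (deg : ι → σ →₀ ℕ) (M : Matrix κ ι K) (b : σ →₀ ℕ) (w : ι → K) : Prop :=
  SupportedBelow deg b w ∧ M.mulVec w = 0

/-- The strands of consecutive maps `M` and `N` of a minimal multigraded resolution: the sequence is
exact in every multidegree. -/
structure StrandExact [Fintype κ] (degι : ι → σ →₀ ℕ) (degκ : κ → σ →₀ ℕ) (M : Matrix κ ι K)
    (N : Matrix μ κ K) : Prop where
  mem_ker : ∀ b w, SupportedBelow degι b w → StrandKer degκ N b (M.mulVec w)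
  exists_lift : ∀ b z, StrandKer degκ N b z → ∃ w, SupportedBelow degι b w ∧ M.mulVec w = z

/-- The kernel is contained in the maximal ideal times the free module. -/
def StrandMinimal (deg : ι → σ →₀ ℕ) (M : Matrix κ ι K) : Prop :=
  ∀ b w, StrandKer deg M b w → ∀ g, deg g = b → w g = 0

variable {degι : ι → σ →₀ ℕ} {degκ : κ → σ →₀ ℕ} {degμ : μ → σ →₀ ℕ}

theorem IsMultigraded.strandExact [Fintype κ] [DecidableEq ι] [DecidableEq κ]
    {φ : (ι → MvPolynomial σ K) →ₗ[MvPolynomial σ K] (κ → MvPolynomial σ K)}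
    {ψ : (κ → MvPolynomial σ K) →ₗ[MvPolynomial σ K] (μ → MvPolynomial σ K)}
    (hφ : IsMultigraded degι degκ φ) (hψ : IsMultigraded degκ degμ ψ)
    (h : LinearMap.ker ψ = LinearMap.range φ) :
    StrandExact degι degκ (strandMatrix degι degκ φ) (strandMatrix degκ degμ ψ) where
  mem_ker b w hw := by
    refine ⟨hw.strandMatrix_mulVec, ?_⟩
    have h0 : ψ (φ (strandLift degι b w)) = 0 := by
      rw [← LinearMap.mem_ker, h]
      exact ⟨_, rfl⟩
    rw [← strandCoord_strandLift hw, ← hφ.strandCoord_apply, ← hψ.strandCoord_apply, h0,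
      strandCoord_zero]
  exists_lift b z hz := by
    have h0 : strandLift degκ b z ∈ LinearMap.range φ := by
      rw [← h, LinearMap.mem_ker, hψ.apply_strandLift hz.1, hz.2, strandLift_zero]
    obtain ⟨y, hy⟩ := h0
    refine ⟨_, strandCoord_supportedBelow degι b y, ?_⟩
    rw [← hφ.strandCoord_apply, hy, strandCoord_strandLift hz.1]

/-- In degree `degι g`, the `g`-coordinate of the lift of `w` is the constant `w g`, which must
vanish. -/
theorem IsMultigraded.strandMinimal [DecidableEq ι]
    {φ : (ι → MvPolynomial σ K) →ₗ[MvPolynomial σ K] (κ → MvPolynomial σ K)}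
    (hφ : IsMultigraded degι degκ φ) (h : IsConstantFree (LinearMap.ker φ)) :
    StrandMinimal degι (strandMatrix degι degκ φ) := by
  rintro b w hw g rfl
  have h0 := h (strandLift degι (degι g) w)
    (by rw [LinearMap.mem_ker, hφ.apply_strandLift hw.1, hw.2, strandLift_zero]) g
  simpa [strandLift] using h0

section

variable [Fintype κ] {M : Matrix κ ι K} {N : Matrix μ κ K}

/-- If the kernel of `N` below `b` is generated in the single degree `c`, then a minimal cover `M`
of it has no kernel in degree `b`. -/
theorem StrandExact.ker_eq_zero (h : StrandExact degι degκ M N) (hmin : StrandMinimal degι M)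
    {b c : σ →₀ ℕ}
    (hb : ∀ b' ≤ b, ∀ z, StrandKer degκ N b' z → z ≠ 0 → c ≤ b' ∧ StrandKer degκ N c z)
    {w : ι → K} (hw : StrandKer degι M b w) : w = 0 := by
  classical
  have key : ∀ g, degι g ≤ b → degι g = c := by
    intro g hg
    -- By minimality the basis element `g` has nonzero image, which by `hb` already lives in degree
    -- `c`.
    have hs : SupportedBelow degι (degι g) (Pi.single g (1 : K)) := supportedBelow_single 1 le_rfl
    have hz := h.mem_ker _ _ hs
    have hne : M.mulVec (Pi.single g 1) ≠ 0 := fun h0 => by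
      have := hmin _ _ ⟨hs, h0⟩ g rfl
      simp at this
    obtain ⟨hle, hc⟩ := hb _ hg _ hz hne
    -- Minimality applied to `g` minus the lift `v` forces `v g = 1`; as `v` is supported below `c`,
    -- so is `g`.
    obtain ⟨v, hv, hvz⟩ := h.exists_lift _ _ hc
    refine le_antisymm (hv g fun h0 => ?_) hle
    have := hmin (degι g) (Pi.single g 1 + -v) ⟨hs.add (hv.mono hle).neg, by
      rw [Matrix.mulVec_add, Matrix.mulVec_neg, hvz, add_neg_cancel]⟩ g rfl
    simp [h0] at this
  have hc : StrandKer degι M c w := ⟨fun g hg => (key g (hw.1 g hg)).le, hw.2⟩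
  funext g
  by_contra hg
  exact hg (hmin c w hc g (key g (hw.1 g hg)))

/-- A minimal nonvanishing degree of the kernel of `N` is the degree of a basis element. -/
theorem StrandExact.exists_deg_eq (h : StrandExact degι degκ M N) {a : σ →₀ ℕ} {z : κ → K}
    (hz : StrandKer degκ N a z) (hne : z ≠ 0)
    (hlt : ∀ b < a, ∀ z, StrandKer degκ N b z → z = 0) : ∃ g, degι g = a := by
  classical
  obtain ⟨w, hw, rfl⟩ := h.exists_lift _ _ hz
  obtain ⟨i, hi⟩ := Function.ne_iff.1 hne
  obtain ⟨g, -, hg⟩ := Finset.exists_ne_zero_of_sum_ne_zero hi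
  -- A basis element of degree strictly below `a` would map to a kernel element in that degree,
  -- hence to zero, and could not contribute to `z`.
  refine ⟨g, (hw g (right_ne_zero_of_mul hg)).eq_of_not_lt fun hlt' => ?_⟩
  have := hlt _ hlt' _ (h.mem_ker _ _ (supportedBelow_single (1 : K) (le_refl (degι g))))
  rw [Matrix.mulVec_single_one] at this
  exact left_ne_zero_of_mul hg (congrFun this i)

end

end StrandKernel

/-! ### Syzygies among the generators dividing a fixed degree. -/

section Augmentation

variable {σ K ι J : Type*} [Field K] [Fintype ι]

/-- Scalars of the augmentation of a minimal resolution of a monomial ideal whose generators of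
degree at most `a` have the degrees `u j`. -/
structure StrandAug (deg : ι → σ →₀ ℕ) (E : Matrix (Fin 1) ι K) (a : σ →₀ ℕ)
    (u : J → σ →₀ ℕ) : Prop where
  minimal : StrandMinimal deg E
  exists_le : ∀ b ≤ a, ∀ z, SupportedBelow deg b z → E.mulVec z ≠ 0 → ∃ j, u j ≤ b
  exists_lift : ∀ j, ∃ z, SupportedBelow deg (u j) z ∧ E.mulVec z = 1
  le : ∀ j, u j ≤ a
  antichain : ∀ i j, u i ≤ u j → i = j

variable {deg : ι → σ →₀ ℕ} {E : Matrix (Fin 1) ι K} {a : σ →₀ ℕ} {u : J → σ →₀ ℕ}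

/-- The basis elements of degree at most `a` correspond to the generators. -/
theorem StrandAug.exists_basis (h : StrandAug deg E a u) :
    ∃ g : J → ι, (∀ j, deg (g j) = u j) ∧ (∀ j, E 0 (g j) ≠ 0) ∧
      ∀ i, deg i ≤ a → ∃ j, i = g j := by
  classical
  have hcol : ∀ i, E.mulVec (Pi.single i 1) = fun _ => E 0 i := by
    intro i
    funext x
    rw [Matrix.mulVec_single_one, Subsingleton.elim x 0]
    rfl
  have hle : ∀ i, deg i ≤ a → E 0 i ≠ 0 → ∃ j, u j ≤ deg i := fun i hi hE =>
    h.exists_le _ hi _ (supportedBelow_single 1 le_rfl) fun h0 =>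
      hE (by rw [hcol] at h0; exact congrFun h0 0)
  have hex : ∀ j, ∃ i, deg i = u j ∧ E 0 i ≠ 0 := by
    intro j
    obtain ⟨z, hz, hz1⟩ := h.exists_lift j
    have h1 : E.mulVec z 0 ≠ 0 := by simp [hz1]
    obtain ⟨i, -, hi⟩ := Finset.exists_ne_zero_of_sum_ne_zero h1
    have hij := hz i (right_ne_zero_of_mul hi)
    obtain ⟨j', hj'⟩ := hle i (hij.trans (h.le j)) (left_ne_zero_of_mul hi)
    obtain rfl := h.antichain _ _ (hj'.trans hij)
    exact ⟨i, le_antisymm hij hj', left_ne_zero_of_mul hi⟩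
  choose g hg hgE using hex
  refine ⟨g, hg, hgE, fun i hi => ?_⟩
  have hE : E 0 i ≠ 0 := fun h0 => by
    have := h.minimal (deg i) (Pi.single i 1)
      ⟨supportedBelow_single 1 le_rfl, by rw [hcol, h0]; rfl⟩ i rfl
    simp at this
  obtain ⟨j, hj⟩ := hle i hi hE
  refine ⟨j, ?_⟩
  by_contra hne
  -- A second basis element over the same generator would give a relation with coefficient 1 at `i`,
  -- against minimality.
  have := h.minimal (deg i) (Pi.single i 1 + -Pi.single (g j) (E 0 i / E 0 (g j)))
    ⟨(supportedBelow_single 1 le_rfl).add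
      (supportedBelow_single _ ((hg j).le.trans hj)).neg, by
        rw [Matrix.mulVec_add, Matrix.mulVec_neg, hcol, Matrix.mulVec_single]
        funext x
        have hx : x = 0 := Subsingleton.elim _ _
        subst hx
        simp [div_eq_mul_inv, mul_left_comm (E 0 (g j)), hgE j]⟩ i rfl
  simp [hne] at this

/-- A nonzero relation involves two of the generators. -/
theorem StrandAug.exists_ne (h : StrandAug deg E a u) {c : σ →₀ ℕ} (hc : c ≤ a) {z : ι → K}
    (hz : StrandKer deg E c z) (hne : z ≠ 0) : ∃ i j, i ≠ j ∧ u i ≤ c ∧ u j ≤ c := by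
  classical
  obtain ⟨g, hg, hgE, hgs⟩ := h.exists_basis
  obtain ⟨i, hi⟩ := Function.ne_iff.1 hne
  obtain ⟨j, rfl⟩ := hgs i ((hz.1 i hi).trans hc)
  by_contra! hcon
  have h0 : E.mulVec z 0 = E 0 (g j) * z (g j) := by
    refine Finset.sum_eq_single _ (fun l _ hl => ?_) (by simp)
    by_contra hne'
    have hl' := hz.1 l (right_ne_zero_of_mul hne')
    obtain ⟨j', rfl⟩ := hgs l (hl'.trans hc)
    exact hcon j j' (fun h => hl (h ▸ rfl)) (hg j ▸ hz.1 _ hi) (hg j' ▸ hl')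
  rw [hz.2] at h0
  exact mul_ne_zero (hgE j) hi h0.symm

/-- Below `a` the basis degrees are exactly the `u j`, so only which `u j` lie below a degree
matters. -/
theorem StrandAug.supportedBelow_of_forall (h : StrandAug deg E a u) {b c : σ →₀ ℕ} (hb : b ≤ a)
    (hbc : ∀ j, u j ≤ b → u j ≤ c) {z : ι → K} (hz : SupportedBelow deg b z) :
    SupportedBelow deg c z := by
  obtain ⟨g, hg, -, hgs⟩ := h.exists_basis
  intro i hi
  have := hz i hi
  obtain ⟨j, rfl⟩ := hgs i (this.trans hb)
  rw [hg] at this ⊢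
  exact hbc j this

/-- The relations between pairs of generators. -/
theorem StrandAug.exists_relations (h : StrandAug deg E a u) :
    ∃ v : J → ι → K, (∀ i j c, u i ≤ c → u j ≤ c → StrandKer deg E c (v i - v j)) ∧
      ∀ i j, i ≠ j → v i - v j ≠ 0 := by
  classical
  obtain ⟨g, hg, hgE, -⟩ := h.exists_basis
  refine ⟨fun j => Pi.single (g j) (E 0 (g j))⁻¹, fun i j c hi hj => ⟨?_, ?_⟩,
    fun i j hij h0 => ?_⟩
  · rw [sub_eq_add_neg]
    exact (supportedBelow_single _ (hg i ▸ hi)).add (supportedBelow_single _ (hg j ▸ hj)).neg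
  · rw [Matrix.mulVec_sub, Matrix.mulVec_single, Matrix.mulVec_single]
    funext x
    have hx : x = 0 := Subsingleton.elim _ _
    subst hx
    simp [hgE]
  · have hne : g i ≠ g j := fun hgij => hij (h.antichain i j (by rw [← hg, ← hg, hgij]))
    have := congrFun h0 (g i)
    simp [hne, hgE] at this

/-- Two generators whose degrees have join `a`, with no second generator strictly below `a`, give
a first syzygy of degree `a`. -/
theorem StrandAug.exists_deg_eq {ι₁ : Type*} [Fintype ι₁] {deg₁ : ι₁ → σ →₀ ℕ}
    {D : Matrix ι ι₁ K} (h : StrandAug deg E a u) (hD : StrandExact deg₁ deg D E) {i j : J}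
    (hij : i ≠ j) (hlt : ∀ b < a, ∀ i j, u i ≤ b → u j ≤ b → i = j) : ∃ g, deg₁ g = a := by
  obtain ⟨v, hv, hv0⟩ := h.exists_relations
  refine hD.exists_deg_eq (hv i j a (h.le i) (h.le j)) (hv0 i j hij) fun b hb z hz => ?_
  by_contra hne
  obtain ⟨i, j, hij, hi, hj⟩ := h.exists_ne hb.le hz hne
  exact hij (hlt b hb i j hi hj)

/-- Three generators `i`, `j`, `l` whose pairwise relations live in the degrees `b₁`, `b₂`, `b₃` give
a second syzygy of degree `a`, if below each smaller degree the relations are generated in a single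
degree. -/
theorem StrandAug.exists_deg_eq_of_triangle {ι₁ ι₂ : Type*} [Fintype ι₁] [Fintype ι₂]
    {deg₁ : ι₁ → σ →₀ ℕ} {deg₂ : ι₂ → σ →₀ ℕ} {D : Matrix ι ι₁ K} {D' : Matrix ι₁ ι₂ K}
    (h : StrandAug deg E a u) (hD : StrandExact deg₁ deg D E) (hmin : StrandMinimal deg₁ D)
    (hD' : StrandExact deg₂ deg₁ D' D) {i j l : J} (hij : i ≠ j) {b₁ b₂ b₃ : σ →₀ ℕ}
    (hb₁ : b₁ ≤ a) (hb₂ : b₂ ≤ a) (hb₃ : b₃ ≤ a)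
    (hi₁ : u i ≤ b₁) (hj₁ : u j ≤ b₁) (hi₂ : u i ≤ b₂) (hl₂ : u l ≤ b₂) (hj₃ : u j ≤ b₃)
    (hl₃ : u l ≤ b₃)
    (h₁₂ : ∀ p q, u p ≤ b₁ → u p ≤ b₂ → u q ≤ b₁ → u q ≤ b₂ → p = q)
    (h₁₃ : ∀ p q, u p ≤ b₁ → u p ≤ b₃ → u q ≤ b₁ → u q ≤ b₃ → p = q)
    (hlt : ∀ b < a, ∃ c, ∀ p, u p ≤ b → u p ≤ c ∧
      ∀ q, p ≠ q → u q ≤ b → ∀ b', u p ≤ b' → u q ≤ b' → c ≤ b') : ∃ g, deg₂ g = a := by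
  classical
  obtain ⟨v, hv, hv0⟩ := h.exists_relations
  obtain ⟨w₁, hw₁, hD₁⟩ := hD.exists_lift _ _ (hv i j b₁ hi₁ hj₁)
  obtain ⟨w₂, hw₂, hD₂⟩ := hD.exists_lift _ _ (hv l i b₂ hl₂ hi₂)
  obtain ⟨w₃, hw₃, hD₃⟩ := hD.exists_lift _ _ (hv j l b₃ hj₃ hl₃)
  -- The three lifts form a cycle because the pairwise relations telescope around the triangle.
  refine hD'.exists_deg_eq (z := w₁ + w₂ + w₃)
    ⟨((hw₁.mono hb₁).add (hw₂.mono hb₂)).add (hw₃.mono hb₃), ?_⟩ ?_ ?_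
  · rw [Matrix.mulVec_add, Matrix.mulVec_add, hD₁, hD₂, hD₃]
    abel
  -- If the sum vanished, each basis element used in `w₁` would also occur in `w₂` or `w₃`, so its
  -- degree would lie below two sides at once. Only one generator does, too few for a nonzero
  -- relation; hence `w₁` would map to zero.
  · intro h0
    refine hv0 i j hij ?_
    rw [← hD₁]
    funext x
    refine Finset.sum_eq_zero fun g _ => ?_
    by_contra hne
    have hg₁ := hw₁ g (right_ne_zero_of_mul hne)
    have hcol : D.mulVec (Pi.single g 1) ≠ 0 := fun hc => by
      rw [Matrix.mulVec_single_one] at hc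
      exact left_ne_zero_of_mul hne (congrFun hc x)
    obtain ⟨p, q, hpq, hp, hq⟩ := h.exists_ne (hg₁.trans hb₁)
      (hD.mem_ker _ _ (supportedBelow_single (1 : K) (le_refl (deg₁ g)))) hcol
    have h0g := congrFun h0 g
    by_cases h2 : w₂ g = 0
    · have h3 : w₃ g ≠ 0 := fun h3 => right_ne_zero_of_mul hne (by simpa [h2, h3] using h0g)
      have hg₃ := hw₃ g h3
      exact hpq (h₁₃ p q (hp.trans hg₁) (hp.trans hg₃) (hq.trans hg₁) (hq.trans hg₃))
    · have hg₂ := hw₂ g h2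
      exact hpq (h₁₂ p q (hp.trans hg₁) (hp.trans hg₂) (hq.trans hg₁) (hq.trans hg₂))
  · intro b hb w hw
    obtain ⟨c, hc⟩ := hlt b hb
    refine hD.ker_eq_zero hmin (b := b) (c := c) (fun b' hb' z hz hne => ?_) hw
    obtain ⟨p, q, hpq, hp, hq⟩ := h.exists_ne (hb'.trans hb.le) hz hne
    exact ⟨(hc p (hp.trans hb')).2 q hpq (hq.trans hb') b' hp hq,
      h.supportedBelow_of_forall (hb'.trans hb.le) (fun r hr => (hc r (hr.trans hb')).1) hz.1,
      hz.2⟩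

end Augmentation

/-! ### From a minimal resolution to strand data. -/

namespace MultigradedFreeResolution

variable {σ K : Type*} [Field K] {I : Ideal (MvPolynomial σ K)}

/-- The scalars of the differential. -/
noncomputable def scalarMatrix (F : MultigradedFreeResolution I) (i : ℕ) :
    Matrix (Fin (F.rank i)) (Fin (F.rank (i + 1))) K :=
  strandMatrix (F.deg (i + 1)) (F.deg i) (F.d i)

/-- The augmentation, as a map into the free module of rank one. -/
noncomputable def augVec (F : MultigradedFreeResolution I) :
    (Fin (F.rank 0) → MvPolynomial σ K) →ₗ[MvPolynomial σ K] (Fin 1 → MvPolynomial σ K) :=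
  LinearMap.pi fun _ => F.aug

theorem isMultigraded_augVec (F : MultigradedFreeResolution I) :
    IsMultigraded (F.deg 0) (fun _ => 0) F.augVec :=
  fun b _ m hm => (add_zero m).trans (F.graded_aug b m hm)

theorem ker_augVec (F : MultigradedFreeResolution I) :
    LinearMap.ker F.augVec = LinearMap.range (F.d 0) := by
  rw [← F.exact_zero]
  ext w
  simp [augVec, funext_iff, LinearMap.mem_ker]

theorem strandExact_zero (F : MultigradedFreeResolution I) :
    StrandExact (F.deg 1) (F.deg 0) (F.scalarMatrix 0)
      (strandMatrix (F.deg 0) (fun _ => 0) F.augVec) :=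
  IsMultigraded.strandExact (F.graded_d 0) F.isMultigraded_augVec F.ker_augVec

theorem strandExact_succ (F : MultigradedFreeResolution I) (i : ℕ) :
    StrandExact (F.deg (i + 2)) (F.deg (i + 1)) (F.scalarMatrix (i + 1)) (F.scalarMatrix i) :=
  IsMultigraded.strandExact (F.graded_d (i + 1)) (F.graded_d i) (F.exact_succ i)

theorem IsMinimal.strandMinimal_succ {F : MultigradedFreeResolution I} (hF : F.IsMinimal) (i : ℕ) :
    StrandMinimal (F.deg (i + 1)) (F.scalarMatrix i) :=
  IsMultigraded.strandMinimal (F.graded_d i)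
    (isConstantFree_of_le_smul_top (F.exact_succ i ▸ hF (i + 1)))

/-- The ideal enters only through its monomials dividing x^`a`, so generators not dividing x^`a`
play no role. -/
theorem IsMinimal.strandAug {J : Type*} {F : MultigradedFreeResolution I} (hF : F.IsMinimal)
    {a : σ →₀ ℕ} {u : J → σ →₀ ℕ} (hI : ∀ b ≤ a, monomial b (1 : K) ∈ I ↔ ∃ j, u j ≤ b)
    (hle : ∀ j, u j ≤ a) (hanti : ∀ i j, u i ≤ u j → i = j) :
    StrandAug (F.deg 0) (strandMatrix (F.deg 0) (fun _ => 0) F.augVec) a u where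
  minimal := F.isMultigraded_augVec.strandMinimal
    (isConstantFree_of_le_smul_top (F.ker_augVec ▸ hF 0))
  exists_le b hb z hz hne := by
    rw [← hI b hb]
    have h1 : F.aug (strandLift (F.deg 0) b z) ∈ I :=
      F.range_aug.le ⟨_, rfl⟩
    have h2 := congrFun (F.isMultigraded_augVec.apply_strandLift hz) 0
    obtain ⟨x, hx⟩ := Function.ne_iff.1 hne
    obtain rfl : x = 0 := Subsingleton.elim _ _
    set c := (strandMatrix (F.deg 0) (fun _ => 0) F.augVec).mulVec z 0 with hc
    have h3 : F.aug (strandLift (F.deg 0) b z) = monomial b c := by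
      refine h2.trans ?_
      rw [strandLift, tsub_zero]
    have h4 := I.mul_mem_left (C c⁻¹) (h3 ▸ h1)
    rwa [C_mul_monomial, inv_mul_cancel₀ hx] at h4
  exists_lift j := by
    classical
    have h1 : monomial (u j) (1 : K) ∈ I := (hI _ (hle j)).2 ⟨j, le_rfl⟩
    rw [← F.range_aug] at h1
    obtain ⟨y, hy⟩ := h1
    refine ⟨_, strandCoord_supportedBelow _ (u j) y, ?_⟩
    rw [← F.isMultigraded_augVec.strandCoord_apply]
    funext x
    have : F.augVec y x = monomial (u j) 1 := hy
    rw [strandCoord, if_pos zero_le, tsub_zero, this, coeff_monomial, if_pos rfl]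
    rfl
  le := hle
  antichain := hanti

end MultigradedFreeResolution

/-! ### Powers of the edge ideal below products of an induced matching. -/

section Combinatorics

variable {V : Type*}

/-- The exponent of the squarefree monomial with support `e`. -/
noncomputable def indExp (e : Finset V) : V →₀ ℕ := ∑ v ∈ e, Finsupp.single v 1

theorem indExp_apply [DecidableEq V] (e : Finset V) (v : V) : indExp e v = if v ∈ e then 1 else 0 := by
  simp [indExp, Finsupp.finsetSum_apply, Finsupp.single_apply]

theorem degree_indExp (e : Finset V) : (indExp e).degree = e.card := by
  simp [indExp, map_sum]

/-- The exponents of the products of `n` monomials with exponents in `E`. -/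
def powExps (E : Set (V →₀ ℕ)) : ℕ → Set (V →₀ ℕ)
  | 0 => {0}
  | n + 1 => Set.image2 (· + ·) (powExps E n) E

theorem span_monomial_pow (K : Type*) [Field K] (E : Set (V →₀ ℕ)) (n : ℕ) :
    Ideal.span ((fun b => monomial b (1 : K)) '' E) ^ n =
      Ideal.span ((fun b => monomial b (1 : K)) '' powExps E n) := by
  induction n with
  | zero => simp [powExps, Ideal.one_eq_top]
  | succ n ih =>
    rw [pow_succ, ih, Ideal.span_mul_span']
    congr 1
    ext p
    simp [powExps, Set.mem_mul, Set.mem_add, monomial_mul]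

theorem Clutter.edgeIdeal_eq (C : Clutter V) (K : Type*) [Field K] :
    C.edgeIdeal K = Ideal.span ((fun b => monomial b (1 : K)) '' (indExp '' C.edges)) := by
  rw [Clutter.edgeIdeal]
  congr 1
  ext p
  simp only [Set.mem_ofPred_eq, Set.image_image, Set.mem_image, Finset.mem_coe]
  refine exists_congr fun e => and_congr_right fun _ => ?_
  rw [indExp, monomial_sum_one, eq_comm]
  rfl

theorem monomial_mem_span_monomial {K : Type*} [Field K] {D : Set (V →₀ ℕ)} {b : V →₀ ℕ} :
    monomial b (1 : K) ∈ Ideal.span ((fun b => monomial b (1 : K)) '' D) ↔ ∃ d ∈ D, d ≤ b := by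
  classical
  rw [mem_ideal_span_monomial_image]
  simp [support_monomial]

variable {t : ℕ} {e : Fin t → Finset V}

/-- The exponent of a monomial in the products of variables over the sets `e j`. -/
noncomputable def famExp (e : Fin t → Finset V) (c : Fin t → ℕ) : V →₀ ℕ := ∑ j, c j • indExp (e j)

theorem famExp_zero : famExp e 0 = 0 := by simp [famExp]

theorem famExp_add (c d : Fin t → ℕ) : famExp e (c + d) = famExp e c + famExp e d := by
  simp [famExp, add_smul, Finset.sum_add_distrib]

theorem famExp_single (j : Fin t) : famExp e (Pi.single j 1) = indExp (e j) := by
  rw [famExp, Finset.sum_eq_single j] <;> simp +contextual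

theorem famExp_apply_of_mem (hdisj : Pairwise fun i j => Disjoint (e i) (e j)) (c : Fin t → ℕ)
    {j : Fin t} {v : V} (hv : v ∈ e j) : famExp e c v = c j := by
  classical
  rw [famExp, Finsupp.finsetSum_apply, Finset.sum_eq_single j]
  · simp [indExp_apply, hv]
  · intro i _ hij
    simp [indExp_apply, Finset.disjoint_right.1 (hdisj hij) hv]
  · simp

theorem exists_mem_of_famExp_ne_zero {c : Fin t → ℕ} {v : V} (hv : famExp e c v ≠ 0) :
    ∃ j, v ∈ e j := by
  classical
  rw [famExp, Finsupp.finsetSum_apply] at hv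
  obtain ⟨j, -, hj⟩ := Finset.exists_ne_zero_of_sum_ne_zero hv
  refine ⟨j, ?_⟩
  by_contra h
  simp [indExp_apply, h] at hj

theorem famExp_le_iff (hdisj : Pairwise fun i j => Disjoint (e i) (e j)) {c : Fin t → ℕ}
    {b : V →₀ ℕ} : famExp e c ≤ b ↔ ∀ j, ∀ v ∈ e j, c j ≤ b v := by
  classical
  constructor
  · intro h j v hv
    rw [← famExp_apply_of_mem hdisj c hv]
    exact h v
  · intro h v
    by_cases hv : famExp e c v = 0
    · simp [hv]
    · obtain ⟨j, hj⟩ := exists_mem_of_famExp_ne_zero hv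
      rw [famExp_apply_of_mem hdisj c hj]
      exact h j v hj

theorem famExp_le_famExp_iff (hdisj : Pairwise fun i j => Disjoint (e i) (e j))
    (hne : ∀ j, (e j).Nonempty) {c d : Fin t → ℕ} : famExp e c ≤ famExp e d ↔ c ≤ d := by
  classical
  rw [famExp_le_iff hdisj]
  refine forall_congr' fun j => ⟨fun h => ?_, fun h v hv => ?_⟩
  · obtain ⟨v, hv⟩ := hne j
    rw [← famExp_apply_of_mem hdisj d hv]
    exact h v hv
  · rwa [famExp_apply_of_mem hdisj d hv]

/-- By disjointness the exponent at a vertex of `e j` is just the `j`-th multiplicity, so lcms are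
coordinatewise maxima. -/
theorem famExp_sup_le (hdisj : Pairwise fun i j => Disjoint (e i) (e j)) {c d : Fin t → ℕ}
    {b : V →₀ ℕ} (hc : famExp e c ≤ b) (hd : famExp e d ≤ b) : famExp e (c ⊔ d) ≤ b := by
  classical
  rw [famExp_le_iff hdisj] at *
  exact fun j v hv => sup_le (hc j v hv) (hd j v hv)

/-- A proper divisor loses an exponent at some vertex of some `e j`, and this single vertex caps the
multiplicity of `e j` in every product dividing it. -/
theorem exists_lt_of_lt_famExp (hdisj : Pairwise fun i j => Disjoint (e i) (e j)) {c : Fin t → ℕ}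
    {b : V →₀ ℕ} (hb : b < famExp e c) : ∃ j, ∀ d, famExp e d ≤ b → d j < c j := by
  classical
  have h : ¬famExp e c ≤ b := hb.not_ge
  rw [famExp_le_iff hdisj] at h
  push Not at h
  obtain ⟨j, v, hv, hlt⟩ := h
  exact ⟨j, fun d hd => ((famExp_le_iff hdisj).1 hd j v hv).trans_lt hlt⟩

theorem degree_famExp {k : ℕ} (he : ∀ j, (e j).card = k) (c : Fin t → ℕ) :
    (famExp e c).degree = k * ∑ j, c j := by
  simp [famExp, map_sum, degree_indExp, he, Finset.mul_sum, mul_comm]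

/-- Pairwise disjoint edges that are the only edges in their union. -/
structure IsInducedFamily [DecidableEq V] (C : Clutter V) (e : Fin t → Finset V) : Prop where
  mem : ∀ j, e j ∈ C.edges
  disjoint : Pairwise fun i j => Disjoint (e i) (e j)
  nonempty : ∀ j, (e j).Nonempty
  induced : ∀ f ∈ C.edges, f ⊆ Finset.univ.biUnion e → ∃ j, f = e j

variable [DecidableEq V]

theorem IsInducedFamily.famExp_mem_powExps {C : Clutter V} (h : IsInducedFamily C e) :
    ∀ (n : ℕ) (c : Fin t → ℕ), ∑ j, c j = n →
      famExp e c ∈ powExps (indExp '' (C.edges : Set (Finset V))) n := by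
  intro n
  induction n with
  | zero =>
    intro c hc
    have : c = 0 := funext fun j => Finset.sum_eq_zero_iff.1 hc j (Finset.mem_univ j)
    simp [this, famExp_zero, powExps]
  | succ n ih =>
    intro c hc
    obtain ⟨j, -, hj⟩ := Finset.exists_ne_zero_of_sum_ne_zero (hc.trans_ne n.succ_ne_zero)
    have hcj : c = (c - Pi.single j 1) + Pi.single j 1 := by
      funext i
      by_cases hi : i = j
      · subst hi
        simp
        omega
      · simp [hi]
    have hsum := congrArg (fun c : Fin t → ℕ => ∑ j, c j) hcj
    simp only [Pi.add_apply, Finset.sum_add_distrib, Finset.sum_pi_single', Finset.mem_univ,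
      if_true, hc] at hsum
    refine ⟨famExp e (c - Pi.single j 1), ih _ ?_, indExp (e j), ⟨e j, h.mem j, rfl⟩, ?_⟩
    · simp only [Pi.sub_apply] at hsum ⊢
      simpa using hsum.symm
    · simp only
      rw [← famExp_single, ← famExp_add, ← hcj]

/-- Every edge occurring in such a product lies in the union of the `e j`, so inducedness makes it
one of them. -/
theorem IsInducedFamily.exists_eq_famExp {C : Clutter V} (h : IsInducedFamily C e)
    {c₀ : Fin t → ℕ} : ∀ (n : ℕ), ∀ d ∈ powExps (indExp '' (C.edges : Set (Finset V))) n,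
      d ≤ famExp e c₀ → ∃ c : Fin t → ℕ, ∑ j, c j = n ∧ d = famExp e c := by
  intro n
  induction n with
  | zero =>
    intro d hd _
    exact ⟨0, by simp, by rw [famExp_zero]; exact hd⟩
  | succ n ih =>
    rintro _ ⟨d, hd, _, ⟨f, hf, rfl⟩, rfl⟩ hle
    obtain ⟨c, hc, rfl⟩ := ih d hd (le_self_add.trans hle)
    obtain ⟨j, rfl⟩ := h.induced f hf fun v hv => by
      have h1 := (le_add_self.trans hle) v
      rw [indExp_apply, if_pos hv] at h1
      obtain ⟨j, hj⟩ := exists_mem_of_famExp_ne_zero (Nat.one_le_iff_ne_zero.1 h1)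
      exact Finset.mem_biUnion.2 ⟨j, Finset.mem_univ _, hj⟩
    refine ⟨c + Pi.single j 1, ?_, ?_⟩
    · simp [Finset.sum_add_distrib, hc]
    · rw [famExp_add, famExp_single]

theorem IsInducedFamily.monomial_mem_iff {C : Clutter V} (h : IsInducedFamily C e)
    (K : Type*) [Field K] {c₀ : Fin t → ℕ} {b : V →₀ ℕ} (hb : b ≤ famExp e c₀) (s : ℕ) :
    monomial b (1 : K) ∈ C.edgeIdeal K ^ s ↔ ∃ c : Fin t → ℕ, ∑ j, c j = s ∧ famExp e c ≤ b := by
  rw [C.edgeIdeal_eq, span_monomial_pow, monomial_mem_span_monomial]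
  constructor
  · rintro ⟨d, hd, hdb⟩
    obtain ⟨c, hc, rfl⟩ := h.exists_eq_famExp s d hd (hdb.trans hb)
    exact ⟨c, hc, hdb⟩
  · rintro ⟨c, hc, hcb⟩
    exact ⟨_, h.famExp_mem_powExps s c hc, hcb⟩

theorem Clutter.exists_isInducedFamily (C : Clutter V) {k : ℕ} (hC : C.IsUniform k) (ht : 2 ≤ t)
    (h : t ≤ C.indMatch) : ∃ e : Fin t → Finset V, IsInducedFamily C e := by
  classical
  rw [Clutter.indMatch, Finset.le_sup_iff (by simpa using (by omega : 0 < t))] at h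
  obtain ⟨M, hM, hcard⟩ := h
  obtain ⟨-, hsub, hdisj, hind⟩ := Finset.mem_filter.1 hM
  obtain ⟨f⟩ := Function.Embedding.nonempty_of_card_le (α := Fin t) (β := M) (by simpa using hcard)
  have hd : Pairwise fun i j => Disjoint (f i).1 (f j).1 := fun i j hij =>
    hdisj _ (f i).2 _ (f j).2 fun h => hij (f.injective (Subtype.ext h))
  -- For `k = 0` the only possible edge is empty, so there cannot be two; this is where `2 ≤ t` is
  -- needed.
  have hk : k ≠ 0 := by
    rintro rfl
    have h0 : ∀ j, (f j).1 = ∅ := fun j => Finset.card_eq_zero.1 (hC _ (hsub (f j).2))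
    have := f.injective (Subtype.ext ((h0 ⟨0, by omega⟩).trans (h0 ⟨1, by omega⟩).symm))
    simp at this
  have hne : ∀ g ∈ C.edges, g.Nonempty := fun g hg => by
    rw [← Finset.card_pos, hC g hg]
    omega
  refine ⟨fun j => (f j).1, fun j => hsub (f j).2, hd, fun j => hne _ (hsub (f j).2),
    fun g hg hgsub => ?_⟩
  have hgM : g ∈ M := hind g hg fun v hv => by
    obtain ⟨j, -, hj⟩ := Finset.mem_biUnion.1 (hgsub hv)
    exact Finset.mem_biUnion.2 ⟨_, (f j).2, hj⟩
  obtain ⟨v, hv⟩ := hne g hg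
  obtain ⟨j, -, hj⟩ := Finset.mem_biUnion.1 (hgsub hv)
  refine ⟨j, ?_⟩
  by_contra hgj
  exact Finset.disjoint_left.1 (hdisj g hgM _ (f j).2 hgj) hv hj

end Combinatorics

/-! ### The forced basis elements and the regularity bounds. -/

section Regularity

variable {K V : Type*} [Field K]

theorem Clutter.exists_minimal_resolution_edgeIdeal_pow [Finite V] (C : Clutter V) (s : ℕ) :
    ∃ F : MultigradedFreeResolution (C.edgeIdeal K ^ s), F.IsMinimal := by
  rw [C.edgeIdeal_eq, span_monomial_pow]
  exact exists_minimal_resolution _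

variable [DecidableEq V]

/-- The regularity is bounded below by the degree of a basis element that every minimal resolution
has. -/
theorem le_cmRegularity [Fintype V] {I : Ideal (MvPolynomial V K)}
    (hex : ∃ F : MultigradedFreeResolution I, F.IsMinimal) {i j : ℕ} {a : V →₀ ℕ}
    (ha : a.degree = i + j)
    (hF : ∀ F : MultigradedFreeResolution I, F.IsMinimal → ∃ g, F.deg i g = a) :
    ((j : ℕ) : WithBot ℕ∞) ≤ cmRegularity I := by
  refine le_sSup ⟨i, j, ?_, rfl⟩
  have hmem : a ∈ Finset.finsuppAntidiag (Finset.univ : Finset V) (i + j) := by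
    rw [Finset.mem_finsuppAntidiag]
    exact ⟨by rw [← ha, Finsupp.degree_eq_sum], Finset.subset_univ _⟩
  refine fun h0 => ?_
  have h1 := Finset.sum_eq_zero_iff.1 h0 a hmem
  rw [multigradedBetti, dif_pos hex, MultigradedFreeResolution.gradedRank, Finset.card_eq_zero] at h1
  obtain ⟨g, hg⟩ := hF hex.choose hex.choose_spec
  exact Finset.notMem_empty g (h1 ▸ Finset.mem_filter.2 ⟨Finset.mem_univ g, hg⟩)

theorem IsInducedFamily.exists_deg_one {C : Clutter V} {e : Fin 2 → Finset V}
    (h : IsInducedFamily C e) (n : ℕ) (F : MultigradedFreeResolution (C.edgeIdeal K ^ (n + 2)))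
    (hF : F.IsMinimal) : ∃ g, F.deg 1 g = famExp e ![n + 2, 1] := by
  let u : Fin 2 → Fin 2 → ℕ := ![![n + 2, 0], ![n + 1, 1]]
  have hanti : ∀ i j, u i ≤ u j → i = j := by
    intro i j
    fin_cases i <;> fin_cases j <;> simp [u, Pi.le_def, Fin.forall_fin_two]
  have hle : ∀ j, u j ≤ ![n + 2, 1] := by
    intro j
    fin_cases j <;> simp [u, Pi.le_def, Fin.forall_fin_two]
  have hgen : ∀ c : Fin 2 → ℕ, ∑ j, c j = n + 2 → c ≤ ![n + 2, 1] → ∃ j, u j ≤ c := by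
    intro c hc hca
    rw [Fin.sum_univ_two] at hc
    have h1 : c 1 ≤ 1 := hca 1
    obtain h0 | h0 : c 1 = 0 ∨ c 1 = 1 := by omega
    · exact ⟨0, by simp [u, Pi.le_def, Fin.forall_fin_two]; omega⟩
    · exact ⟨1, by simp [u, Pi.le_def, Fin.forall_fin_two]; omega⟩
  have hsum : ∀ j, ∑ i, u j i = n + 2 := by
    intro j
    fin_cases j <;> simp [u]
  have haug := hF.strandAug (a := famExp e ![n + 2, 1]) (u := fun j => famExp e (u j))
    (fun b hb => by
      rw [h.monomial_mem_iff K hb]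
      constructor
      · rintro ⟨c, hc, hcb⟩
        obtain ⟨j, hj⟩ := hgen c hc
          ((famExp_le_famExp_iff h.disjoint h.nonempty).1 (hcb.trans hb))
        exact ⟨j, ((famExp_le_famExp_iff h.disjoint h.nonempty).2 hj).trans hcb⟩
      · rintro ⟨j, hj⟩
        exact ⟨u j, hsum j, hj⟩)
    (fun j => (famExp_le_famExp_iff h.disjoint h.nonempty).2 (hle j))
    (fun i j hij => hanti i j ((famExp_le_famExp_iff h.disjoint h.nonempty).1 hij))
  refine haug.exists_deg_eq F.strandExact_zero (i := 0) (j := 1) (by simp) fun b hb i j hi hj => ?_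
  -- A drop in the first coordinate leaves only (n+1, 1), a drop in the second only (n+2, 0).
  obtain ⟨p, hp⟩ := exists_lt_of_lt_famExp h.disjoint hb
  have hpi := hp _ hi
  have hpj := hp _ hj
  revert hpi hpj
  fin_cases p <;> fin_cases i <;> fin_cases j <;> simp [u]

/-- The exponents `c ≤ (n + 2, 1, 1)` with sum `n + 2`. -/
def triangleExp (n : ℕ) : Fin 4 → Fin 3 → ℕ :=
  ![![n + 2, 0, 0], ![n + 1, 1, 0], ![n + 1, 0, 1], ![n, 1, 1]]

theorem triangleExp_antichain (n : ℕ) (i j : Fin 4) (h : triangleExp n i ≤ triangleExp n j) :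
    i = j := by
  revert h
  fin_cases i <;> fin_cases j <;> simp [triangleExp, Pi.le_def, Fin.forall_fin_succ]

theorem triangleExp_le (n : ℕ) (j : Fin 4) : triangleExp n j ≤ ![n + 2, 1, 1] := by
  fin_cases j <;> simp [triangleExp, Pi.le_def, Fin.forall_fin_succ]

theorem sum_triangleExp (n : ℕ) (j : Fin 4) : ∑ i, triangleExp n j i = n + 2 := by
  fin_cases j <;> simp [triangleExp, Fin.sum_univ_three]

theorem exists_triangleExp_le {n : ℕ} {c : Fin 3 → ℕ} (hc : ∑ j, c j = n + 2)
    (hca : c ≤ ![n + 2, 1, 1]) : ∃ j, triangleExp n j ≤ c := by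
  rw [Fin.sum_univ_three] at hc
  have h1 : c 1 ≤ 1 := hca 1
  have h2 : c 2 ≤ 1 := hca 2
  obtain h1 | h1 : c 1 = 0 ∨ c 1 = 1 := by omega
  · obtain h2 | h2 : c 2 = 0 ∨ c 2 = 1 := by omega
    · exact ⟨0, by simp [triangleExp, Pi.le_def, Fin.forall_fin_succ]; omega⟩
    · exact ⟨2, by simp [triangleExp, Pi.le_def, Fin.forall_fin_succ]; omega⟩
  · obtain h2 | h2 : c 2 = 0 ∨ c 2 = 1 := by omega
    · exact ⟨1, by simp [triangleExp, Pi.le_def, Fin.forall_fin_succ]; omega⟩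
    · exact ⟨3, by simp [triangleExp, Pi.le_def, Fin.forall_fin_succ]; omega⟩

/-- The exponents that are smaller than `(n + 2, 1, 1)` in a given coordinate have the same pairwise
joins. -/
theorem exists_join_triangleExp (n : ℕ) (j : Fin 3) : ∃ c : Fin 3 → ℕ,
    ∀ p, triangleExp n p j < (![n + 2, 1, 1] : Fin 3 → ℕ) j → triangleExp n p ≤ c ∧
      ∀ q, p ≠ q → triangleExp n q j < (![n + 2, 1, 1] : Fin 3 → ℕ) j →
        c ≤ triangleExp n p ⊔ triangleExp n q := by
  -- Lowering the first coordinate leaves the last three exponents, any two with join (n+1, 1, 1);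
  -- lowering another leaves just two exponents, and their join is the witness.
  refine ⟨![![n + 1, 1, 1], ![n + 2, 0, 1], ![n + 2, 1, 0]] j, fun p hp => ⟨?_, ?_⟩⟩
  · revert hp
    fin_cases j <;> fin_cases p <;> simp [triangleExp, Pi.le_def, Fin.forall_fin_succ]
  · intro q
    revert hp
    fin_cases j <;> fin_cases p <;> fin_cases q <;>
      simp [triangleExp, Pi.le_def, Fin.forall_fin_succ]

/-- The degrees of two sides of the triangle have only the shared vertex below both, so no first
syzygy lies below both. -/
theorem eq_zero_of_triangleExp_le {n : ℕ} {p : Fin 4} (h₁ : triangleExp n p ≤ ![n + 2, 1, 0])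
    (h₂ : triangleExp n p ≤ ![n + 2, 0, 1]) : p = 0 := by
  revert h₁ h₂
  fin_cases p <;> simp [triangleExp, Pi.le_def, Fin.forall_fin_succ]

theorem eq_one_of_triangleExp_le {n : ℕ} {p : Fin 4} (h₁ : triangleExp n p ≤ ![n + 2, 1, 0])
    (h₂ : triangleExp n p ≤ ![n + 1, 1, 1]) : p = 1 := by
  revert h₁ h₂
  fin_cases p <;> simp [triangleExp, Pi.le_def, Fin.forall_fin_succ]

theorem IsInducedFamily.exists_deg_two {C : Clutter V} {e : Fin 3 → Finset V}
    (h : IsInducedFamily C e) (n : ℕ) (F : MultigradedFreeResolution (C.edgeIdeal K ^ (n + 2)))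
    (hF : F.IsMinimal) : ∃ g, F.deg 2 g = famExp e ![n + 2, 1, 1] := by
  have hff : ∀ {c d : Fin 3 → ℕ}, famExp e c ≤ famExp e d ↔ c ≤ d :=
    famExp_le_famExp_iff h.disjoint h.nonempty
  have haug := hF.strandAug (a := famExp e ![n + 2, 1, 1])
    (u := fun j => famExp e (triangleExp n j))
    (fun b hb => by
      rw [h.monomial_mem_iff K hb]
      constructor
      · rintro ⟨c, hc, hcb⟩
        obtain ⟨j, hj⟩ := exists_triangleExp_le hc (hff.1 (hcb.trans hb))
        exact ⟨j, (hff.2 hj).trans hcb⟩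
      · rintro ⟨j, hj⟩
        exact ⟨_, sum_triangleExp n j, hj⟩)
    (fun j => hff.2 (triangleExp_le n j))
    (fun i j hij => triangleExp_antichain n i j (hff.1 hij))
  have hb : ∀ {c d : Fin 3 → ℕ}, (∀ i, c i ≤ d i) → famExp e c ≤ famExp e d := hff.2
  refine haug.exists_deg_eq_of_triangle F.strandExact_zero (hF.strandMinimal_succ 0)
    (F.strandExact_succ 0) (i := 0) (j := 1) (l := 2) (by simp)
    (b₁ := famExp e ![n + 2, 1, 0]) (b₂ := famExp e ![n + 2, 0, 1])
    (b₃ := famExp e ![n + 1, 1, 1])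
    (hb (by simp [Fin.forall_fin_succ])) (hb (by simp [Fin.forall_fin_succ]))
    (hb (by simp [Fin.forall_fin_succ])) (hb (by simp [triangleExp, Fin.forall_fin_succ]))
    (hb (by simp [triangleExp, Fin.forall_fin_succ]))
    (hb (by simp [triangleExp, Fin.forall_fin_succ]))
    (hb (by simp [triangleExp, Fin.forall_fin_succ]))
    (hb (by simp [triangleExp, Fin.forall_fin_succ]))
    (hb (by simp [triangleExp, Fin.forall_fin_succ])) ?_ ?_ ?_
  · intro p q hp₁ hp₂ hq₁ hq₂
    rw [eq_zero_of_triangleExp_le (hff.1 hp₁) (hff.1 hp₂),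
      eq_zero_of_triangleExp_le (hff.1 hq₁) (hff.1 hq₂)]
  · intro p q hp₁ hp₂ hq₁ hq₂
    rw [eq_one_of_triangleExp_le (hff.1 hp₁) (hff.1 hp₂),
      eq_one_of_triangleExp_le (hff.1 hq₁) (hff.1 hq₂)]
  · intro b hb
    obtain ⟨j, hj⟩ := exists_lt_of_lt_famExp h.disjoint hb
    obtain ⟨c, hc⟩ := exists_join_triangleExp n j
    refine ⟨famExp e c, fun p hp => ⟨hff.2 (hc p (hj _ hp)).1, fun q hpq hq b' hpb hqb => ?_⟩⟩
    exact (hff.2 ((hc p (hj _ hp)).2 q hpq (hj _ hq))).trans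
      (famExp_sup_le h.disjoint hpb hqb)

end Regularity

theorem corollary3p4 {K : Type*} [Field K] {V : Type*} [Fintype V] [DecidableEq V]
    (C : Clutter V) (k s : ℕ) (hC : C.IsUniform k) (hs : 2 ≤ s) :
    (C.indMatch = 2 →
      ((k * s + k - 1 : ℕ) : WithBot ℕ∞) ≤ cmRegularity (C.edgeIdeal K ^ s)) ∧
    (3 ≤ C.indMatch →
      ((k * s + 2 * k - 2 : ℕ) : WithBot ℕ∞) ≤ cmRegularity (C.edgeIdeal K ^ s)) := by
  -- The exponent (s-2, 1, 1) among the four generators is where `s ≥ 2` enters.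
  obtain ⟨n, rfl⟩ : ∃ n, s = n + 2 := ⟨s - 2, by omega⟩
  constructor
  · intro h
    obtain ⟨e, he⟩ := C.exists_isInducedFamily hC le_rfl h.ge
    -- Positivity of `k` keeps the natural-number subtraction in the bound from truncating.
    have hk : 0 < k := hC _ (he.mem 0) ▸ (he.nonempty 0).card_pos
    refine le_cmRegularity (C.exists_minimal_resolution_edgeIdeal_pow (n + 2)) (i := 1) ?_
      (he.exists_deg_one n)
    rw [degree_famExp fun j => hC _ (he.mem j)]
    simp only [Fin.sum_univ_two, Matrix.cons_val_zero, Matrix.cons_val_one, mul_add, mul_one]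
    omega
  · intro h
    obtain ⟨e, he⟩ := C.exists_isInducedFamily hC (by omega) h
    have hk : 0 < k := hC _ (he.mem 0) ▸ (he.nonempty 0).card_pos
    refine le_cmRegularity (C.exists_minimal_resolution_edgeIdeal_pow (n + 2)) (i := 2) ?_
      (he.exists_deg_two n)
    rw [degree_famExp fun j => hC _ (he.mem j)]
    simp only [Fin.sum_univ_three, Matrix.cons_val_zero, Matrix.cons_val_one, Matrix.cons_val,
      mul_add, mul_one]
    omega
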